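/- Let $q$ be a prime power, $N\ge 4$ an even integer and $\mu\ge 2$ an integer, and let $PG(N,q)$ be the $N$-dimensional projective space over the field with $q$ elements. A point set $S\subseteq PG(N,q)$ is $(1,\mu)$-saturating if for every point $Q\notin S$ one has $\sum_{\ell\ni Q}\binom{\#(\ell\cap S)}{2}\ge\mu$, the sum being over all lines $\ell$ through $Q$; let $s_\mu(N,q)$ be the smallest size of such a set. A linear code $C\subseteq\mathbb F_q^n$ of covering radius $R$ (in the Hamming metric) is an $(R,\mu)$-MCF code (multiple covering of the farthest-off points) if every word at distance $R$ from $C$ is at distance exactly $R$ from at least $\mu$ codewords; let $\ell_\mu(R,r,q)$ be the smallest length $n$ of a linear $q$-ary $(R,\mu)$-MCF code with covering radius $R$, codimension $r$ and minimum distance at least $3$ (that is, the columns of a parity check matrix represent distinct points of $PG(r-1,q)$; no condition if the code is $\{0\}$). Let $\delta=1/\sqrt{(q+1)\ln(q+1)}$ and let $D_\mu$ be the value given by any row of the following list whose conditions are satisfied: $$D_\mu=\begin{cases}2.4&\text{if }\mu=2,\ q\ge 97,\\ 2.6&\text{if }\mu=3,\ q\ge 181,\\ 2.8&\text{if }\mu=4,\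 q\ge 125,\\ \mu+1&\text{if }\mu\le\sqrt q,\ q\ge 4,\\ 2\mu-1&\text{if }\mu\le\frac12\big((1-\delta)q-\delta+1\big)+1,\ q\ge 3.\end{cases}$$ Put $n_{q,\mu}=2D_\mu\sqrt{(q+1)\ln(q+1)}+2$. If $q^{\frac{N-2}{2}}+1-\mu\ge n_{q,\mu}$, then both minima exist and $$s_\mu(N,q)=\ell_\mu(2,N+1,q)\le q^{\frac{N-2}{2}}\,n_{q,\mu}+\max(3,\mu)\,\frac{q^{\frac{N-2}{2}}-1}{q-1}.$$ Moreover, for fixed $N$, the right-hand side is asymptotically equal ($\sim$) to $2D_\mu\,q^{\frac{N-1}{2}}\sqrt{\ln q}$ as $q\to\infty$, where $\mu\ge 2$ and the row used for $D_\mu$ may vary with $q$ as long as the conditions of that row are satisfied. -/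

import Mathlib

open scoped LinearAlgebra.Projectivization
open Filter Asymptotics

/-- The projective space `PG(N, q)` over a field `K` with `q` elements. -/
abbrev PG (K : Type*) [Field K] (N : ℕ) : Type _ := ℙ K (Fin (N + 1) → K)

/-- The points of `S` on the subspace (for `finrank W = 2`: the line) given by `W`. -/
def pointsOn {K : Type*} [Field K] {N : ℕ} (S : Set (PG K N))
    (W : Submodule K (Fin (N + 1) → K)) : Set (PG K N) :=
  {P | P ∈ S ∧ P.submodule ≤ W}

/-- The number of secants of `S` through `Q`, counted with multiplicity: the sum over all lines `W`
through `Q` of `binom (#(W ∩ S)) 2`. (A line that is not a secant contributes `0`; over a finite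
field there are finitely many lines, so the finite-support sum is a genuine sum.) -/
noncomputable def secantCount {K : Type*} [Field K] {N : ℕ} (S : Set (PG K N)) (Q : PG K N) : ℕ :=
  ∑ᶠ W ∈ {W : Submodule K (Fin (N + 1) → K) | Module.finrank K W = 2 ∧ Q.submodule ≤ W},
    ((pointsOn S W).ncard).choose 2

/-- `S` is a `(1, μ)`-saturating set in `PG(N, q)`. -/
def IsSaturating {K : Type*} [Field K] {N : ℕ} (μ : ℕ) (S : Set (PG K N)) : Prop :=
  ∀ Q : PG K N, Q ∉ S → μ ≤ secantCount S Q

/-- The sizes of the `(1, μ)`-saturating sets in `PG(N, q)`. -/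
def saturatingSizes (K : Type*) [Field K] (μ N : ℕ) : Set ℕ :=
  {n | ∃ S : Set (PG K N), S.Finite ∧ IsSaturating μ S ∧ S.ncard = n}

/-- `s_μ(N, q)`, the smallest size of a `(1, μ)`-saturating set in `PG(N, q)`. -/
noncomputable def sMu (K : Type*) [Field K] (μ N : ℕ) : ℕ := sInf (saturatingSizes K μ N)

/-- The Hamming distance `d(x, C)` of a word `x` from a linear code `C`. -/
noncomputable def distToCode {K : Type*} [Field K] [DecidableEq K] {n : ℕ}
    (C : Submodule K (Fin n → K)) (x : Fin n → K) : ℕ :=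
  sInf {d | ∃ c ∈ C, hammingDist x c = d}

/-- The covering radius of a linear code: the least `ρ` such that each word is within Hamming
distance `ρ` of some codeword. -/
noncomputable def coveringRadius {K : Type*} [Field K] [DecidableEq K] {n : ℕ}
    (C : Submodule K (Fin n → K)) : ℕ :=
  sInf {ρ | ∀ x : Fin n → K, ∃ c ∈ C, hammingDist x c ≤ ρ}

/-- `C` is an `(R, μ)`-multiple covering of the farthest-off points (`(R, μ)`-MCF code): it has
covering radius `R`, and for each word at distance `R` from `C` there are at least `μ` codewords at
distance `R` from it. -/
def IsMCF {K : Type*} [Field K] [DecidableEq K] {n : ℕ} (R μ : ℕ)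
    (C : Submodule K (Fin n → K)) : Prop :=
  coveringRadius C = R ∧
    ∀ x : Fin n → K, distToCode C x = R → μ ≤ {c | c ∈ C ∧ hammingDist x c = R}.ncard

/-- Each nonzero codeword has weight at least `3`; equivalently, the columns of a parity check
matrix are nonzero and pairwise non-proportional, i.e. they represent distinct points of a
projective space. -/
def MinDistGeThree {K : Type*} [Field K] [DecidableEq K] {n : ℕ}
    (C : Submodule K (Fin n → K)) : Prop :=
  ∀ c ∈ C, c ≠ 0 → 3 ≤ hammingNorm c

/-- The lengths `n` of the linear `[n, n - r]_q (R, μ)`-MCF codes with minimum distance at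
least `3`. -/
def mcfLengths (K : Type*) [Field K] [DecidableEq K] (μ R r : ℕ) : Set ℕ :=
  {n | ∃ C : Submodule K (Fin n → K),
    Module.finrank K C + r = n ∧ MinDistGeThree C ∧ IsMCF R μ C}

/-- The `μ`-length function `ℓ_μ(R, r, q)`. -/
noncomputable def ellMu (K : Type*) [Field K] [DecidableEq K] (μ R r : ℕ) : ℕ :=
  sInf (mcfLengths K μ R r)

/-- `δ = 1 / √((q + 1) ln (q + 1))`. -/
noncomputable def deltaQ (q : ℕ) : ℝ := 1 / √(((q : ℝ) + 1) * Real.log ((q : ℝ) + 1))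

/-- `D` is a value of `D_μ` given by some row of the table whose conditions on `μ` and `q` hold
(the rows overlap, and each applicable row may be used). -/
def IsDMu (q μ : ℕ) (D : ℝ) : Prop :=
  (μ = 2 ∧ 97 ≤ q ∧ D = 2.4) ∨
  (μ = 3 ∧ 181 ≤ q ∧ D = 2.6) ∨
  (μ = 4 ∧ 125 ≤ q ∧ D = 2.8) ∨
  ((μ : ℝ) ≤ √(q : ℝ) ∧ 4 ≤ q ∧ D = (μ : ℝ) + 1) ∨
  ((μ : ℝ) ≤ 1 / 2 * ((1 - deltaQ q) * (q : ℝ) - deltaQ q + 1) + 1 ∧ 3 ≤ q ∧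
    D = 2 * (μ : ℝ) - 1)

/-- `n_{q,μ} = 2 D_μ √((q + 1) ln (q + 1)) + 2`, as a function of `q` and the value `D` of `D_μ`. -/
noncomputable def nQMu (q : ℕ) (D : ℝ) : ℝ :=
  2 * D * √(((q : ℝ) + 1) * Real.log ((q : ℝ) + 1)) + 2

/-- `q^((N-2)/2) n_{q,μ} + max(3, μ) (q^((N-2)/2) - 1) / (q - 1)`. It is used for even `N ≥ 4` only,
where the exponent, computed in `ℕ`, is exact. -/
noncomputable def spaceBound (N q μ : ℕ) (D : ℝ) : ℝ :=
  (q : ℝ) ^ ((N - 2) / 2) * nQMu q D +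
    max 3 (μ : ℝ) * (((q : ℝ) ^ ((N - 2) / 2) - 1) / ((q : ℝ) - 1))

/-!
A code of codimension `N + 1` and minimum distance at least `3` is given by a parity check matrix
whose columns represent distinct points of `PG(N, q)`. The words of weight `2` with a given syndrome
`w`, for `w` not a multiple of a column, correspond to the pairs of columns spanning `w`
(`ncard_weight_two_eq`), and the number of these pairs is the number of secants through the point
`w`, with multiplicity (`secantCount_range_eq`). Hence MCF codes of covering radius `2` and
saturating sets other than the whole space are the same thing, and the two minima agree once such
a saturating set exists (`sMu_eq_ellMu_of_isSaturating`).

To construct one, write `N = 2m + 2` and start in the plane with points `(1 : 0 : x)`, `x ∈ A`, and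
`(0 : 1 : y)`, `y ∈ B`. This set is saturating if each image of `A` under an affine bijection of the
field meets `B` in `μ` points (`le_ncard_spanningPairs_twoLines`). For an arbitrary `A` with
`s = ⌊D √((q + 1) log (q + 1))⌋` elements, a greedy choice of `s` elements produces such a `B`: each
affine image has a weight which is halved by each element of `B` in it, until it has been met `μ`
times, and a suitable element decreases the total weight at least by the average factor. After `s`
steps the total weight is too small for a single image met less than `μ` times
(`exists_card_inter_ge`); all rows of the table satisfy the resulting inequality
(`IsDMu.exists_ratio`, `mul_pow_lt_of_ratio`). If `s ≥ q`, then `A` and `B` are the whole field.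

Let `F` be the extension of degree `m` of the field. The lines through the origin of the plane `F²`
are `m`-dimensional subspaces over the base field, any two of them complementary. Assigning distinct
slopes in `F` to the points of the plane set, and `max 3 μ` further slopes that contribute the points
of their lines, lifts the plane set to `PG(N, q)`: two complementary lines give exactly one secant
through a given point (`le_ncard_spanningPairs_liftVectors`). The size condition of the theorem says
that there are enough slopes.
-/

/-! ### Secants as pairs of column vectors -/

/-- The pairs of indices whose vectors span a subspace containing `w`. -/
def spanningPairs {K V ι : Type*} [Field K] [AddCommGroup V] [Module K V]
    (v : ι → V) (w : V) : Set (Finset ι) :=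
  {T | T.card = 2 ∧ w ∈ Submodule.span K (v '' (T : Set ι))}

/-- The vectors `v i` are nonzero and pairwise non-proportional: they represent distinct points of
the projective space. -/
def RepresentsDistinct (K : Type*) {V ι : Type*} [Field K] [AddCommGroup V] [Module K V]
    (v : ι → V) : Prop :=
  (∀ i, v i ≠ 0) ∧ ∀ i j (a : K), v i = a • v j → i = j

section Pairs

variable {K V ι : Type*} [Field K] [AddCommGroup V] [Module K V] {v : ι → V} {w : V}

theorem mem_spanningPairs_pair [DecidableEq ι] {i j : ι} (hij : i ≠ j) (a b : K)
    (h : a • v i + b • v j = w) : {i, j} ∈ spanningPairs (K := K) v w := by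
  refine ⟨Finset.card_pair hij, ?_⟩
  rw [Finset.coe_pair, Set.image_pair, Submodule.mem_span_pair]
  exact ⟨a, b, h⟩

theorem exists_of_mem_spanningPairs [DecidableEq ι] {T : Finset ι}
    (hT : T ∈ spanningPairs (K := K) v w) :
    ∃ i j, i ≠ j ∧ T = {i, j} ∧ ∃ a b : K, a • v i + b • v j = w := by
  obtain ⟨h2, hw⟩ := hT
  obtain ⟨i, j, hij, rfl⟩ := Finset.card_eq_two.1 h2
  rw [Finset.coe_pair, Set.image_pair, Submodule.mem_span_pair] at hw
  exact ⟨i, j, hij, rfl, hw⟩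

theorem RepresentsDistinct.linearIndependent_pair (hv : RepresentsDistinct K v) {i j : ι}
    (hij : i ≠ j) : LinearIndependent K ![v i, v j] := by
  rw [LinearIndependent.pair_iff' (hv.1 i)]
  intro a ha
  exact hij (hv.2 j i a ha.symm).symm

theorem RepresentsDistinct.finrank_span_pair (hv : RepresentsDistinct K v) {T : Finset ι}
    (hT : T.card = 2) : Module.finrank K (Submodule.span K (v '' (T : Set ι))) = 2 := by
  classical
  obtain ⟨i, j, hij, rfl⟩ := Finset.card_eq_two.1 hT
  have h := finrank_span_eq_card (hv.linearIndependent_pair hij)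
  rw [Finset.coe_pair, Set.image_pair]
  rwa [Matrix.range_cons, Matrix.range_cons, Matrix.range_empty, Set.union_empty,
    Set.singleton_union, Fintype.card_fin] at h

theorem RepresentsDistinct.map (hv : RepresentsDistinct K v) {V' : Type*} [AddCommGroup V']
    [Module K V'] (e : V ≃ₗ[K] V') : RepresentsDistinct K (e ∘ v) := by
  refine ⟨fun i => by simpa using hv.1 i, fun i j a h => hv.2 i j a (e.injective ?_)⟩
  simpa using h

theorem spanningPairs_map {V' : Type*} [AddCommGroup V'] [Module K V'] (e : V ≃ₗ[K] V') :
    spanningPairs (K := K) (e ∘ v) (e w) = spanningPairs (K := K) v w := by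
  ext T
  simp only [spanningPairs, Set.mem_ofPred_eq, Set.image_comp]
  have : Submodule.span K (e '' (v '' (T : Set ι))) =
      (Submodule.span K (v '' (T : Set ι))).map (e : V →ₗ[K] V') := by
    rw [Submodule.map_span]; rfl
  rw [this, Submodule.mem_map]
  simp

/-- A vector `w` which is no multiple of a single `v i` is a combination of two of the `v i` in
exactly one way for each pair spanning it: the coefficient vectors of weight `2` correspond to
their supports. -/
theorem ncard_weight_two_eq [Fintype ι] [DecidableEq K]
    (hv : RepresentsDistinct K v) (hw : ∀ i (a : K), a • v i ≠ w) :
    {y : ι → K | hammingNorm y = 2 ∧ ∑ i, y i • v i = w}.ncard =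
      (spanningPairs (K := K) v w).ncard := by
  classical
  have hsum : ∀ (y : ι → K) (i j : ι), i ≠ j → Finset.univ.filter (fun k => y k ≠ 0) = {i, j} →
      ∑ k, y k • v k = y i • v i + y j • v j := by
    intro y i j hij hy
    rw [← Finset.sum_pair (f := fun k => y k • v k) hij, ← hy]
    refine (Finset.sum_filter_of_ne fun k _ hk => ?_).symm
    rintro h0
    rw [h0, zero_smul] at hk
    exact hk rfl
  refine Set.ncard_congr (fun y _ => Finset.univ.filter (fun k => y k ≠ 0)) ?_ ?_ ?_
  · rintro y ⟨h2, hy⟩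
    obtain ⟨i, j, hij, hT⟩ := Finset.card_eq_two.1 h2
    rw [hT]
    exact mem_spanningPairs_pair hij (y i) (y j) (by rw [← hsum y i j hij hT, hy])
  · rintro y z ⟨h2, hy⟩ ⟨-, hz⟩ hyz
    obtain ⟨i, j, hij, hT⟩ := Finset.card_eq_two.1 h2
    have e1 := hsum y i j hij hT
    have e2 := hsum z i j hij (hyz ▸ hT)
    have h3 := LinearIndependent.pair_iff.1 (hv.linearIndependent_pair hij) (y i - z i) (y j - z j)
      (by rw [sub_smul, sub_smul, sub_add_sub_comm, ← e1, ← e2, hy, hz, sub_self])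
    funext k
    by_cases hk : k ∈ ({i, j} : Finset ι)
    · rw [Finset.mem_insert, Finset.mem_singleton] at hk
      rcases hk with rfl | rfl
      · exact sub_eq_zero.1 h3.1
      · exact sub_eq_zero.1 h3.2
    · have a1 : y k = 0 := by rw [← hT] at hk; simpa using hk
      have a2 : z k = 0 := by rw [← hT, hyz] at hk; simpa using hk
      rw [a1, a2]
  · intro T hT
    obtain ⟨i, j, hij, rfl, a, b, hab⟩ := exists_of_mem_spanningPairs hT
    have ha : a ≠ 0 := by
      rintro rfl
      exact hw j b (by rw [← hab, zero_smul, zero_add])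
    have hb : b ≠ 0 := by
      rintro rfl
      exact hw i a (by rw [← hab, zero_smul, add_zero])
    have hs : Finset.univ.filter (fun k => (Pi.single i a + Pi.single j b : ι → K) k ≠ 0) =
        {i, j} := by
      ext k
      simp only [Finset.mem_filter, Finset.mem_univ, true_and, Finset.mem_insert,
        Finset.mem_singleton, Pi.add_apply, Pi.single_apply]
      by_cases h1 : k = i
      · subst h1; simp [hij, ha]
      · by_cases h2 : k = j
        · subst h2; simp [h1, hb]
        · simp [h1, h2]
    refine ⟨Pi.single i a + Pi.single j b, ⟨?_, ?_⟩, hs⟩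
    · exact (congrArg Finset.card hs).trans (Finset.card_pair hij)
    · rw [hsum _ i j hij hs]
      simpa [hij, hij.symm] using hab

/-- The number of secants through a point, counted with multiplicity, is the number of pairs of
points of the set whose line contains it. -/
theorem secantCount_range_eq {K ι : Type*} [Field K] [Finite K] [Fintype ι] {N : ℕ}
    {v : ι → Fin (N + 1) → K} (hv : RepresentsDistinct K v) {w : Fin (N + 1) → K} (hw : w ≠ 0) :
    secantCount (Set.range fun i => Projectivization.mk K (v i) (hv.1 i))
      (Projectivization.mk K w hw) = (spanningPairs (K := K) v w).ncard := by
  classical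
  have : Finite (Submodule K (Fin (N + 1) → K)) :=
    Finite.of_injective (fun W => (W : Set (Fin (N + 1) → K))) SetLike.coe_injective
  have hfin : {W : Submodule K (Fin (N + 1) → K) | Module.finrank K W = 2 ∧
      (Projectivization.mk K w hw).submodule ≤ W}.Finite := Set.toFinite _
  have hpf : (spanningPairs (K := K) v w).Finite := Set.toFinite _
  have hpi : Function.Injective fun i => Projectivization.mk K (v i) (hv.1 i) := by
    intro i j hij
    obtain ⟨a, ha⟩ := (Projectivization.mk_eq_mk_iff' K _ _ (hv.1 i) (hv.1 j)).1 hij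
    exact hv.2 i j a ha.symm
  have hon : ∀ W : Submodule K (Fin (N + 1) → K),
      (pointsOn (Set.range fun i => Projectivization.mk K (v i) (hv.1 i)) W).ncard =
        (Finset.univ.filter fun i => v i ∈ W).card := by
    intro W
    have : pointsOn (Set.range fun i => Projectivization.mk K (v i) (hv.1 i)) W =
        (fun i => Projectivization.mk K (v i) (hv.1 i)) ''
          ((Finset.univ.filter fun i => v i ∈ W : Finset ι) : Set ι) := by
      ext P
      simp only [pointsOn, Set.mem_ofPred_eq, Set.mem_range, Set.mem_image, Finset.coe_filter,
        Finset.mem_univ, true_and]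
      constructor
      · rintro ⟨⟨i, rfl⟩, hi⟩
        rw [Projectivization.submodule_mk, Submodule.span_singleton_le_iff_mem] at hi
        exact ⟨i, hi, rfl⟩
      · rintro ⟨i, hi, rfl⟩
        rw [Projectivization.submodule_mk, Submodule.span_singleton_le_iff_mem]
        exact ⟨⟨i, rfl⟩, hi⟩
    rw [this, Set.ncard_image_of_injective _ hpi, Set.ncard_coe_finset]
  rw [secantCount, finsum_mem_eq_finite_toFinset_sum _ hfin, Set.ncard_eq_toFinset_card _ hpf,
    Finset.card_eq_sum_card_fiberwise (t := hfin.toFinset)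
      (f := fun T : Finset ι => Submodule.span K (v '' (T : Set ι)))]
  · refine Finset.sum_congr rfl fun W hW => ?_
    rw [Set.Finite.mem_toFinset] at hW
    obtain ⟨h2, hwW⟩ := hW
    rw [Projectivization.submodule_mk, Submodule.span_singleton_le_iff_mem] at hwW
    rw [hon, ← Finset.card_powersetCard]
    congr 1
    ext T
    simp only [Finset.mem_powersetCard, Finset.mem_filter, Set.Finite.mem_toFinset]
    constructor
    · rintro ⟨hT, hc⟩
      have hle : Submodule.span K (v '' (T : Set ι)) ≤ W := by
        rw [Submodule.span_le]
        rintro _ ⟨i, hi, rfl⟩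
        simpa using hT hi
      have heq : Submodule.span K (v '' (T : Set ι)) = W :=
        Submodule.eq_of_le_of_finrank_eq hle (by rw [hv.finrank_span_pair hc, h2])
      exact ⟨⟨hc, heq ▸ hwW⟩, heq⟩
    · rintro ⟨⟨hc, -⟩, rfl⟩
      refine ⟨fun i hi => ?_, hc⟩
      simpa using Submodule.subset_span (R := K) (Set.mem_image_of_mem v hi)
  · intro T hT
    rw [Finset.mem_coe, Set.Finite.mem_toFinset] at hT ⊢
    refine ⟨hv.finrank_span_pair hT.1, ?_⟩
    rw [Projectivization.submodule_mk, Submodule.span_singleton_le_iff_mem]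
    exact hT.2

/-- The saturation property in terms of vectors representing the points of the set. -/
theorem isSaturating_range_iff {K ι : Type*} [Field K] [Finite K] [Fintype ι] {N μ : ℕ}
    {v : ι → Fin (N + 1) → K} (hv : RepresentsDistinct K v) :
    IsSaturating μ (Set.range fun i => Projectivization.mk K (v i) (hv.1 i)) ↔
      ∀ w : Fin (N + 1) → K, (∀ i (a : K), a • v i ≠ w) → w ≠ 0 →
        μ ≤ (spanningPairs (K := K) v w).ncard := by
  have hmem : ∀ (w : Fin (N + 1) → K) (hw : w ≠ 0), Projectivization.mk K w hw ∉
      (Set.range fun i => Projectivization.mk K (v i) (hv.1 i)) ↔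
        ∀ i (a : K), a • v i ≠ w := by
    intro w hw
    simp only [Set.mem_range, not_exists, eq_comm (a := Projectivization.mk K (v _) _),
      Projectivization.mk_eq_mk_iff', ne_eq]
  constructor
  · intro h w hw h0
    rw [← secantCount_range_eq hv h0]
    exact h _ ((hmem w h0).2 hw)
  · intro h Q
    induction Q using Projectivization.ind with | h w h0 =>
    intro hQ
    rw [secantCount_range_eq hv h0]
    exact h w ((hmem w h0).1 hQ) h0

end Pairs

/-! ### Codes and saturating sets -/

section Codes

variable {K : Type*} [Field K] [DecidableEq K] {n : ℕ}

theorem distToCode_le_iff (C : Submodule K (Fin n → K)) (x : Fin n → K) (d : ℕ) :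
    distToCode C x ≤ d ↔ ∃ c ∈ C, hammingDist x c ≤ d := by
  constructor
  · intro h
    have hne : {d | ∃ c ∈ C, hammingDist x c = d}.Nonempty := ⟨_, 0, C.zero_mem, rfl⟩
    obtain ⟨c, hc, hd⟩ := Nat.sInf_mem hne
    exact ⟨c, hc, hd.le.trans h⟩
  · rintro ⟨c, hc, hd⟩
    exact (Nat.sInf_le (s := {d | ∃ c ∈ C, hammingDist x c = d}) ⟨c, hc, rfl⟩).trans hd

theorem hammingDist_eq_hammingNorm_sub (x y : Fin n → K) :
    hammingDist x y = hammingNorm (x - y) := by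
  rw [hammingDist_comm, hammingDist_eq_hammingNorm, neg_add_eq_sub]

theorem exists_of_hammingNorm_le_one {y : Fin n → K} (hy : hammingNorm y ≤ 1) :
    y = 0 ∨ ∃ i a, y = Pi.single i a := by
  rcases Nat.le_one_iff_eq_zero_or_eq_one.1 hy with h | h
  · exact Or.inl (hammingNorm_eq_zero.1 h)
  · obtain ⟨i, hi⟩ := Finset.card_eq_one.1 h
    refine Or.inr ⟨i, y i, funext fun k => ?_⟩
    by_cases hk : k = i
    · subst hk; simp
    · have : k ∉ Finset.univ.filter (fun i => y i ≠ 0) := by rw [hi]; simpa using hk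
      rw [Pi.single_eq_of_ne hk]
      simpa using this

variable {V : Type*} [AddCommGroup V] [Module K V] (v : Fin n → V)

theorem exists_hammingDist_ker_le_iff (x : Fin n → K) (d : ℕ) :
    (∃ c ∈ LinearMap.ker (Fintype.linearCombination K v), hammingDist x c ≤ d) ↔
      ∃ y, hammingNorm y ≤ d ∧
        Fintype.linearCombination K v y = Fintype.linearCombination K v x := by
  constructor
  · rintro ⟨c, hc, hd⟩
    refine ⟨x - c, by rwa [← hammingDist_eq_hammingNorm_sub], ?_⟩
    rw [map_sub, LinearMap.mem_ker.1 hc, sub_zero]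
  · rintro ⟨y, hd, hy⟩
    refine ⟨x - y, by rw [LinearMap.mem_ker, map_sub, hy, sub_self], ?_⟩
    rwa [hammingDist_eq_hammingNorm_sub, sub_sub_cancel]

theorem ncard_hammingDist_ker_eq (x : Fin n → K) (d : ℕ) :
    {c | c ∈ LinearMap.ker (Fintype.linearCombination K v) ∧ hammingDist x c = d}.ncard =
      {y : Fin n → K | hammingNorm y = d ∧ ∑ i, y i • v i = Fintype.linearCombination K v x}.ncard := by
  refine Set.ncard_congr (fun c _ => x - c) ?_ ?_ ?_
  · rintro c ⟨hc, hd⟩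
    refine ⟨by rwa [← hammingDist_eq_hammingNorm_sub], ?_⟩
    rw [← Fintype.linearCombination_apply, map_sub, LinearMap.mem_ker.1 hc, sub_zero]
  · intro c c' _ _ h
    simpa using h
  · rintro y ⟨hd, hy⟩
    rw [← Fintype.linearCombination_apply] at hy
    refine ⟨x - y, ⟨by rw [LinearMap.mem_ker, map_sub, hy, sub_self], ?_⟩, sub_sub_cancel x y⟩
    rwa [hammingDist_eq_hammingNorm_sub, sub_sub_cancel]

theorem minDistGeThree_ker_iff :
    MinDistGeThree (LinearMap.ker (Fintype.linearCombination K v)) ↔ RepresentsDistinct K v := by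
  constructor
  · intro h
    constructor
    · intro i hi
      have h3 := h (Pi.single i 1) (by simp [hi]) (by simp)
      have hle : hammingNorm (Pi.single i (1 : K) : Fin n → K) ≤ 1 := by
        refine (Finset.card_le_card (t := {i}) fun k hk => ?_).trans (Finset.card_singleton i).le
        rw [Finset.mem_singleton]
        by_contra hki
        simp [Pi.single_eq_of_ne hki] at hk
      omega
    · intro i j a hij
      by_contra hne
      have h3 := h (Pi.single i 1 - Pi.single j a) (by simp [hij])
        (fun h0 => by simpa [hne] using congrFun h0 i)
      have hle : hammingNorm (Pi.single i (1 : K) - Pi.single j a : Fin n → K) ≤ 2 := by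
        refine (Finset.card_le_card (t := {i, j}) fun k hk => ?_).trans Finset.card_le_two
        rw [Finset.mem_insert, Finset.mem_singleton]
        by_contra hki
        push Not at hki
        simp [Pi.single_eq_of_ne hki.1, Pi.single_eq_of_ne hki.2] at hk
      omega
  · intro hv c hc hc0
    rw [LinearMap.mem_ker, Fintype.linearCombination_apply] at hc
    by_contra hlt
    have hcases : hammingNorm c ≤ 1 ∨ hammingNorm c = 2 := by omega
    rcases hcases with h1 | h2
    · obtain h | ⟨i, a, rfl⟩ := exists_of_hammingNorm_le_one h1
      · exact hc0 h
      · rw [← Fintype.linearCombination_apply, Fintype.linearCombination_apply_single,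
          smul_eq_zero] at hc
        rcases hc with rfl | hc
        · exact hc0 (Pi.single_zero i)
        · exact hv.1 i hc
    · obtain ⟨i, j, hij, hT⟩ := Finset.card_eq_two.1 h2
      have hs : c i • v i + c j • v j = 0 := by
        rw [← hc, ← Finset.sum_pair (f := fun k => c k • v k) hij, ← hT]
        refine Finset.sum_filter_of_ne fun k _ hk h0 => hk ?_
        rw [h0, zero_smul]
      have hi : i ∈ Finset.univ.filter (fun k => c k ≠ 0) := by rw [hT]; simp
      exact (Finset.mem_filter.1 hi).2
        (LinearIndependent.pair_iff.1 (hv.linearIndependent_pair hij) _ _ hs).1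

/-- The distance of a word from the code with parity check columns `v` is at most `1` exactly if
its syndrome is zero or represents one of the points given by the columns. -/
theorem distToCode_ker_le_one_iff
    (x : Fin n → K) (hx : Fintype.linearCombination K v x ≠ 0) :
    distToCode (LinearMap.ker (Fintype.linearCombination K v)) x ≤ 1 ↔
      ∃ i, ∃ a : K, a • v i = Fintype.linearCombination K v x := by
  rw [distToCode_le_iff, exists_hammingDist_ker_le_iff]
  constructor
  · rintro ⟨y, hy, hyx⟩
    obtain rfl | ⟨i, a, rfl⟩ := exists_of_hammingNorm_le_one hy
    · rw [map_zero] at hyx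
      exact absurd hyx.symm hx
    · rw [Fintype.linearCombination_apply_single] at hyx
      exact ⟨i, a, hyx⟩
  · rintro ⟨i, a, h⟩
    refine ⟨Pi.single i a, ?_, by rw [Fintype.linearCombination_apply_single, h]⟩
    refine (Finset.card_le_card (t := {i}) fun k hk => ?_).trans (Finset.card_singleton i).le
    rw [Finset.mem_singleton]
    by_contra hki
    simp [Pi.single_eq_of_ne hki] at hk

end Codes

section Correspondence

variable {K : Type*} [Field K] [Fintype K] [DecidableEq K] {μ N n : ℕ}

/-- The columns of a parity check matrix of an MCF code of covering radius `2` form a saturating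
set. -/
theorem mem_saturatingSizes_of_mem_mcfLengths (h : n ∈ mcfLengths K μ 2 (N + 1)) :
    n ∈ saturatingSizes K μ N := by
  obtain ⟨C, hdim, hmin, hcov, hmcf⟩ := h
  have hq : Module.finrank K ((Fin n → K) ⧸ C) = Module.finrank K (Fin (N + 1) → K) := by
    have := Submodule.finrank_quotient_add_finrank C
    rw [Module.finrank_fin_fun] at this ⊢
    omega
  let e : ((Fin n → K) ⧸ C) ≃ₗ[K] (Fin (N + 1) → K) := LinearEquiv.ofFinrankEq _ _ hq
  let H : (Fin n → K) →ₗ[K] (Fin (N + 1) → K) := e.toLinearMap ∘ₗ C.mkQ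
  let v : Fin n → Fin (N + 1) → K := fun i => H (Pi.single i 1)
  have hH : Fintype.linearCombination K v = H := by
    refine LinearMap.pi_ext' fun i => LinearMap.ext_ring ?_
    simp [v]
  have hker : LinearMap.ker (Fintype.linearCombination K v) = C := by
    rw [hH, LinearEquiv.ker_comp, Submodule.ker_mkQ]
  have hsurj : Function.Surjective (Fintype.linearCombination K v) := by
    rw [hH]
    exact e.surjective.comp C.mkQ_surjective
  rw [← hker] at hmin hcov hmcf
  have hv := (minDistGeThree_ker_iff v).1 hmin
  refine ⟨Set.range fun i => Projectivization.mk K (v i) (hv.1 i), Set.toFinite _, ?_, ?_⟩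
  · rw [isSaturating_range_iff hv]
    intro w hw h0
    obtain ⟨x, rfl⟩ := hsurj w
    have hcovmem : ∀ x : Fin n → K, ∃ c ∈ LinearMap.ker (Fintype.linearCombination K v),
        hammingDist x c ≤ 2 := by
      have hne : {ρ | ∀ x : Fin n → K, ∃ c ∈ LinearMap.ker (Fintype.linearCombination K v),
          hammingDist x c ≤ ρ}.Nonempty :=
        ⟨n, fun x => ⟨0, Submodule.zero_mem _, by
          simpa using hammingDist_le_card_fintype (x := x) (y := 0)⟩⟩
      have := Nat.sInf_mem hne
      rwa [show sInf _ = 2 from hcov] at this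
    have hd2 : distToCode (LinearMap.ker (Fintype.linearCombination K v)) x = 2 := by
      have h1 := (distToCode_le_iff _ x 2).2 (hcovmem x)
      have h2 : ¬ distToCode (LinearMap.ker (Fintype.linearCombination K v)) x ≤ 1 := by
        rw [distToCode_ker_le_one_iff v x h0]
        push Not
        exact hw
      omega
    rw [← ncard_weight_two_eq hv hw, ← ncard_hammingDist_ker_eq]
    exact hmcf x hd2
  · rw [← Set.image_univ, Set.ncard_image_of_injective, Set.ncard_univ, Nat.card_fin]
    intro i j hij
    obtain ⟨a, ha⟩ := (Projectivization.mk_eq_mk_iff' K _ _ (hv.1 i) (hv.1 j)).1 hij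
    exact hv.2 i j a ha.symm

/-- A saturating set other than the whole space yields an MCF code. For the whole space the code is
a Hamming code, of covering radius `1`. -/
theorem ncard_mem_mcfLengths_of_isSaturating {S : Set (PG K N)} (hμ : 1 ≤ μ)
    (hS : IsSaturating μ S) (huniv : S ≠ Set.univ) :
    S.ncard ∈ mcfLengths K μ 2 (N + 1) := by
  obtain ⟨n, hn⟩ : ∃ n, S.ncard = n := ⟨_, rfl⟩
  have hfin : Finite S := Set.toFinite S
  let p : Fin n ≃ S := (Finite.equivFinOfCardEq (by rw [Nat.card_coe_set_eq, hn])).symm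
  let v : Fin n → Fin (N + 1) → K := fun i => (p i : PG K N).rep
  have hmk : ∀ i, Projectivization.mk K (v i) (Projectivization.rep_nonzero _) = p i :=
    fun i => Projectivization.mk_rep _
  have hv : RepresentsDistinct K v := by
    refine ⟨fun i => Projectivization.rep_nonzero _, fun i j a h => ?_⟩
    apply p.injective
    apply Subtype.ext
    rw [← hmk i, ← hmk j, Projectivization.mk_eq_mk_iff']
    exact ⟨a, h.symm⟩
  have hrange : (Set.range fun i => Projectivization.mk K (v i) (hv.1 i)) = S := by
    ext P
    constructor
    · rintro ⟨i, rfl⟩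
      dsimp only
      rw [hmk i]
      exact (p i).2
    · intro hP
      exact ⟨p.symm ⟨P, hP⟩, by dsimp only; rw [hmk, Equiv.apply_symm_apply]⟩
  have hsat := hS
  rw [← hrange, isSaturating_range_iff hv] at hsat
  have hrep : ∀ w : Fin (N + 1) → K, ∃ y, hammingNorm y ≤ 2 ∧
      Fintype.linearCombination K v y = w := by
    intro w
    by_cases h0 : w = 0
    · exact ⟨0, by simp, by simp [h0]⟩
    by_cases hw : ∀ i (a : K), a • v i ≠ w
    · have h1 := hsat w hw h0
      rw [← ncard_weight_two_eq hv hw] at h1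
      obtain ⟨y, hy2, hy⟩ := Set.nonempty_of_ncard_ne_zero (by omega :
        {y : Fin n → K | hammingNorm y = 2 ∧ ∑ i, y i • v i = w}.ncard ≠ 0)
      exact ⟨y, hy2.le, by rw [Fintype.linearCombination_apply, hy]⟩
    · push Not at hw
      obtain ⟨i, a, ha⟩ := hw
      have := (distToCode_ker_le_one_iff v (Pi.single i a)
        (by rwa [Fintype.linearCombination_apply_single, ha])).2
        ⟨i, a, (Fintype.linearCombination_apply_single ..).symm⟩
      rw [distToCode_le_iff, exists_hammingDist_ker_le_iff] at this
      obtain ⟨y, hy1, hy⟩ := this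
      exact ⟨y, hy1.trans one_le_two, by rw [hy, Fintype.linearCombination_apply_single, ha]⟩
  have hsurj : Function.Surjective (Fintype.linearCombination K v) := fun w =>
    (hrep w).imp fun y hy => hy.2
  rw [hn]
  refine ⟨LinearMap.ker (Fintype.linearCombination K v), ?_, (minDistGeThree_ker_iff v).2 hv,
    ?_, ?_⟩
  · have := LinearMap.finrank_range_add_finrank_ker (Fintype.linearCombination K v)
    rw [LinearMap.range_eq_top.2 hsurj, finrank_top, Module.finrank_fin_fun,
      Module.finrank_fin_fun] at this
    omega
  · have h2 : 2 ∈ {ρ | ∀ x : Fin n → K, ∃ c ∈ LinearMap.ker (Fintype.linearCombination K v),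
        hammingDist x c ≤ ρ} := fun x => (exists_hammingDist_ker_le_iff v x 2).2 (hrep _)
    refine le_antisymm (Nat.sInf_le h2) (le_csInf ⟨2, h2⟩ fun ρ hρ => ?_)
    obtain ⟨Q, hQ⟩ := (Set.ne_univ_iff_exists_notMem S).1 huniv
    induction Q using Projectivization.ind with | h w h0 =>
    obtain ⟨x, rfl⟩ := hsurj w
    by_contra hlt
    obtain ⟨c, hc, hd⟩ := hρ x
    obtain ⟨i, a, ha⟩ := (distToCode_ker_le_one_iff v x h0).1
      ((distToCode_le_iff _ x 1).2 ⟨c, hc, by omega⟩)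
    apply hQ
    rw [← hrange]
    exact ⟨i, ((Projectivization.mk_eq_mk_iff' K _ _ h0 (hv.1 i)).2 ⟨a, ha⟩).symm⟩
  · intro x hx
    have h0 : Fintype.linearCombination K v x ≠ 0 := by
      intro h0
      have := (distToCode_le_iff (LinearMap.ker (Fintype.linearCombination K v)) x 0).2
        ⟨x, h0, by simp⟩
      omega
    have hw : ∀ i (a : K), a • v i ≠ Fintype.linearCombination K v x := by
      intro i a ha
      have := (distToCode_ker_le_one_iff v x h0).2 ⟨i, a, ha⟩
      omega
    rw [ncard_hammingDist_ker_eq, ncard_weight_two_eq hv hw]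
    exact hsat _ hw h0

/-- As soon as some saturating set is not the whole space, the smallest saturating sets and the
shortest MCF codes have the same size. -/
theorem sMu_eq_ellMu_of_isSaturating {S : Set (PG K N)} (hμ : 1 ≤ μ) (hS : IsSaturating μ S)
    (huniv : S ≠ Set.univ) :
    (saturatingSizes K μ N).Nonempty ∧ (mcfLengths K μ 2 (N + 1)).Nonempty ∧
      sMu K μ N = ellMu K μ 2 (N + 1) ∧ sMu K μ N ≤ S.ncard := by
  have hmem : S.ncard ∈ saturatingSizes K μ N := ⟨S, Set.toFinite S, hS, rfl⟩
  have hmcf := ncard_mem_mcfLengths_of_isSaturating hμ hS huniv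
  have hle : sMu K μ N ≤ S.ncard := Nat.sInf_le hmem
  refine ⟨⟨_, hmem⟩, ⟨_, hmcf⟩, le_antisymm ?_ ?_, hle⟩
  · exact Nat.sInf_le (mem_saturatingSizes_of_mem_mcfLengths (Nat.sInf_mem ⟨_, hmcf⟩))
  · obtain ⟨S', -, hS', hcard⟩ := Nat.sInf_mem ⟨_, hmem⟩
    have hu' : S' ≠ Set.univ := by
      rintro rfl
      have hlt : S.ncard < (Set.univ : Set (PG K N)).ncard :=
        Set.ncard_lt_ncard (Set.ssubset_univ_iff.2 huniv) (Set.toFinite _)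
      have : sMu K μ N = (Set.univ : Set (PG K N)).ncard := hcard.symm
      omega
    have := ncard_mem_mcfLengths_of_isSaturating hμ hS' hu'
    rw [hcard] at this
    exact Nat.sInf_le this

end Correspondence

/-! ### A greedy multiple covering of a uniform hypergraph -/

section Greedy

variable {α ι : Type*} [DecidableEq α]

/-- The weight of an edge `e` not yet covered `μ` times by `B`: it is halved by each point of `B`
on the edge, and it drops to `0` once the edge has been covered `μ` times. -/
noncomputable def edgeWeight (μ : ℕ) (B e : Finset α) : ℝ :=
  if (e ∩ B).card < μ then (1 / 2) ^ (e ∩ B).card else 0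

theorem edgeWeight_nonneg (μ : ℕ) (B e : Finset α) : 0 ≤ edgeWeight μ B e := by
  unfold edgeWeight
  split_ifs <;> positivity

theorem edgeWeight_insert_of_mem_le (μ : ℕ) {B e : Finset α} {b : α} (hb : b ∉ B) (hbe : b ∈ e) :
    edgeWeight μ (insert b B) e ≤ edgeWeight μ B e / 2 := by
  have hc : (e ∩ insert b B).card = (e ∩ B).card + 1 := by
    rw [Finset.inter_insert_of_mem hbe, Finset.card_insert_of_notMem (by simp [hb])]
  unfold edgeWeight
  rw [hc]
  split_ifs with h1 h2
  · rw [pow_succ]; linarith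
  · omega
  · positivity
  · simp

theorem edgeWeight_insert_of_notMem (μ : ℕ) {B e : Finset α} {b : α} (hbe : b ∉ e) :
    edgeWeight μ (insert b B) e = edgeWeight μ B e := by
  unfold edgeWeight
  rw [Finset.inter_insert_of_notMem hbe]

variable [Fintype α]

/-- Averaged over the points outside `B`, adding a point decreases the weight of an edge with `a`
points by the factor `1 - (a + 1 - μ) / (2 * card α)`. -/
theorem sum_edgeWeight_insert_le {μ a : ℕ} (hμ : μ ≤ a + 1) {B e : Finset α} (he : e.card = a) :
    ∑ b ∈ Bᶜ, edgeWeight μ (insert b B) e ≤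
      Bᶜ.card • ((1 - ((a : ℝ) + 1 - μ) / (2 * Fintype.card α)) * edgeWeight μ B e) := by
  have hstep : ∑ b ∈ Bᶜ, edgeWeight μ (insert b B) e ≤
      ∑ b ∈ Bᶜ, (edgeWeight μ B e - if b ∈ e then edgeWeight μ B e / 2 else 0) := by
    refine Finset.sum_le_sum fun b hb => ?_
    rw [Finset.mem_compl] at hb
    split_ifs with h
    · linarith [edgeWeight_insert_of_mem_le μ hb h]
    · rw [edgeWeight_insert_of_notMem μ h, sub_zero]
  refine hstep.trans ?_
  rw [Finset.sum_sub_distrib, Finset.sum_const, ← Finset.sum_filter, Finset.sum_const,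
    nsmul_eq_mul, nsmul_eq_mul, nsmul_eq_mul]
  by_cases hlt : (e ∩ B).card < μ
  · have hcard : (Bᶜ.filter (· ∈ e)).card + (e ∩ B).card = a := by
      rw [← he, ← Finset.card_sdiff_add_card_inter e B]
      congr 2
      ext b
      simp [and_comm]
    have h1 : (a : ℝ) + 1 - μ ≤ (Bᶜ.filter (· ∈ e)).card := by
      have : a + 1 ≤ (Bᶜ.filter (· ∈ e)).card + μ := by omega
      have : (a : ℝ) + 1 ≤ (Bᶜ.filter (· ∈ e)).card + μ := by exact_mod_cast this
      linarith
    have h0 : (0 : ℝ) ≤ (a : ℝ) + 1 - μ := by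
      have : (μ : ℝ) ≤ a + 1 := by exact_mod_cast hμ
      linarith
    have h2 : (Bᶜ.card : ℝ) * (((a : ℝ) + 1 - μ) / (2 * Fintype.card α)) ≤
        ((a : ℝ) + 1 - μ) / 2 := by
      have hle : (Bᶜ.card : ℝ) ≤ Fintype.card α := by exact_mod_cast Finset.card_le_univ _
      rcases (Nat.cast_nonneg (α := ℝ) (Fintype.card α)).eq_or_lt with h | h
      · rw [← h]; simp; linarith
      · rw [mul_div_assoc', div_le_div_iff₀ (by positivity) (by positivity)]
        nlinarith
    have hw := edgeWeight_nonneg μ B e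
    nlinarith [mul_le_mul_of_nonneg_right (h2.trans (div_le_div_of_nonneg_right h1 two_pos.le)) hw]
  · have hz : edgeWeight μ B e = 0 := if_neg hlt
    simp [hz]

variable [Fintype ι]

/-- The greedy choice: adding in each step a point that decreases the total weight at least as much
as the average does, the weight decreases geometrically. -/
theorem exists_sum_edgeWeight_le (E : ι → Finset α) {μ a : ℕ} (hμ : μ ≤ a + 1)
    (hE : ∀ i, (E i).card = a) (ha : a ≤ Fintype.card α) (hμ0 : 0 < μ)
    (s : ℕ) (hs : s ≤ Fintype.card α) :
    ∃ B : Finset α, B.card = s ∧ ∑ i, edgeWeight μ B (E i) ≤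
      Fintype.card ι * (1 - ((a : ℝ) + 1 - μ) / (2 * Fintype.card α)) ^ s := by
  induction s with
  | zero =>
    refine ⟨∅, rfl, ?_⟩
    simp [edgeWeight, hμ0]
  | succ s ih =>
    obtain ⟨B, hB, hsum⟩ := ih (by omega)
    have hne : Bᶜ.Nonempty := by
      rw [← Finset.card_pos, Finset.card_compl]; omega
    have hr : 0 ≤ 1 - ((a : ℝ) + 1 - μ) / (2 * Fintype.card α) := by
      have hq : (0 : ℝ) < Fintype.card α := by exact_mod_cast (by omega : 0 < Fintype.card α)
      have h1 : (a : ℝ) ≤ Fintype.card α := by exact_mod_cast ha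
      have h2 : (1 : ℝ) ≤ μ := by exact_mod_cast hμ0
      rw [sub_nonneg, div_le_one (by positivity)]
      linarith
    obtain ⟨b, hb, hle⟩ := Finset.exists_le_of_sum_le hne
      (f := fun b => ∑ i, edgeWeight μ (insert b B) (E i))
      (g := fun _ => (1 - ((a : ℝ) + 1 - μ) / (2 * Fintype.card α)) *
        ∑ i, edgeWeight μ B (E i)) (by
        rw [Finset.sum_comm, Finset.sum_const, Finset.mul_sum, Finset.smul_sum]
        exact Finset.sum_le_sum fun i _ => sum_edgeWeight_insert_le hμ (hE i))
    refine ⟨insert b B, ?_, hle.trans ?_⟩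
    · rw [Finset.card_insert_of_notMem (Finset.mem_compl.1 hb), hB]
    · refine (mul_le_mul_of_nonneg_left hsum hr).trans_eq ?_
      rw [pow_succ]; ring

theorem exists_card_inter_ge (E : ι → Finset α) {μ a : ℕ} (hμ : μ ≤ a + 1)
    (hE : ∀ i, (E i).card = a) (ha : a ≤ Fintype.card α) (hμ0 : 0 < μ)
    (s : ℕ) (hs : s ≤ Fintype.card α)
    (hlt : (Fintype.card ι : ℝ) * (1 - ((a : ℝ) + 1 - μ) / (2 * Fintype.card α)) ^ s <
      (1 / 2) ^ (μ - 1)) :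
    ∃ B : Finset α, B.card = s ∧ ∀ i, μ ≤ (E i ∩ B).card := by
  obtain ⟨B, hB, hsum⟩ := exists_sum_edgeWeight_le E hμ hE ha hμ0 s hs
  refine ⟨B, hB, fun i => ?_⟩
  by_contra hi
  have h1 : edgeWeight μ B (E i) ≤ ∑ i, edgeWeight μ B (E i) :=
    Finset.single_le_sum (f := fun i => edgeWeight μ B (E i))
      (fun i _ => edgeWeight_nonneg μ B (E i)) (Finset.mem_univ i)
  have h2 : edgeWeight μ B (E i) = (1 / 2) ^ (E i ∩ B).card := if_pos (by omega)
  have h3 : ((1 : ℝ) / 2) ^ (μ - 1) ≤ (1 / 2) ^ (E i ∩ B).card :=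
    pow_le_pow_of_le_one (by norm_num) (by norm_num) (by omega)
  linarith

end Greedy

/-! ### Saturating sets on two lines of a plane -/

theorem Finset.card_le_ncard_of_injOn {α β : Type*} [Finite β] (s : Finset α) (t : Set β)
    (f : α → β) (hf : ∀ a ∈ s, f a ∈ t) (hinj : Set.InjOn f s) : s.card ≤ t.ncard := by
  rw [← Set.ncard_coe_finset]
  exact Set.ncard_le_ncard_of_injOn f hf hinj (Set.toFinite t)

/-- Every image of `A` under an affine bijection of the field meets `B` in at least `μ` points. -/
def MeetsAffineImages {K : Type*} [Field K] [DecidableEq K] (μ : ℕ) (A B : Finset K) : Prop :=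
  ∀ t z : K, t ≠ 0 → μ ≤ (A.image (fun x => z + t * x) ∩ B).card

section Plane

variable {K : Type*} [Field K]

/-- Vectors representing the points `(1 : 0 : x)`, `x ∈ A`, and `(0 : 1 : y)`, `y ∈ B`, of two lines
of the plane; the common point `(0 : 0 : 1)` of the lines is omitted. -/
def twoLines (A B : Finset K) : A ⊕ B → K × K × K :=
  Sum.elim (fun x => (1, 0, (x : K))) (fun y => (0, 1, (y : K)))

theorem representsDistinct_twoLines (A B : Finset K) : RepresentsDistinct K (twoLines A B) := by
  refine ⟨?_, ?_⟩
  · rintro (x | y) <;> simp [twoLines]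
  · rintro (x | y) (x' | y') a h <;>
      simp only [twoLines, Sum.elim_inl, Sum.elim_inr, Prod.smul_mk, smul_eq_mul, Prod.mk.injEq,
        mul_one, mul_zero] at h
    · obtain ⟨rfl, -, h⟩ := h
      rw [one_mul] at h
      rw [Subtype.ext h]
    · exact absurd h.1 one_ne_zero
    · exact absurd h.2.1 one_ne_zero
    · obtain ⟨-, rfl, h⟩ := h
      rw [one_mul] at h
      rw [Subtype.ext h]

variable [DecidableEq K]

/-- The two-line set is saturating: the points of one of the two lines lie on that secant, and the
secants through any other point correspond to the points of an affine image of `A` in `B`, given by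
the projection from one line to the other. -/
theorem le_ncard_spanningPairs_twoLines {μ : ℕ} {A B : Finset K}
    (hAB : MeetsAffineImages μ A B) (hA : μ ≤ A.card.choose 2) (hB : μ ≤ B.card.choose 2)
    (a : K × K × K) : μ ≤ (spanningPairs (K := K) (twoLines A B) a).ncard := by
  obtain ⟨s, t, z⟩ := a
  by_cases ht : t = 0
  · subst ht
    refine hA.trans ?_
    rw [← Fintype.card_coe A, ← Finset.card_univ, ← Finset.card_powersetCard]
    refine Finset.card_le_ncard_of_injOn _ _ (fun T => T.map ⟨Sum.inl, Sum.inl_injective⟩) ?_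
      (Finset.map_injective _).injOn
    intro T hT
    obtain ⟨x, y, hxy, rfl⟩ := Finset.card_eq_two.1 (Finset.mem_powersetCard.1 hT).2
    rw [Finset.map_insert, Finset.map_singleton]
    have hne : (y : K) - x ≠ 0 := sub_ne_zero.2 fun h => hxy (Subtype.ext h.symm)
    refine mem_spanningPairs_pair (by simpa using hxy) (s - (z - s * x) / (y - x))
      ((z - s * x) / (y - x)) ?_
    simp only [twoLines, Function.Embedding.coeFn_mk, Sum.elim_inl, Prod.smul_mk, smul_eq_mul,
      Prod.mk_add_mk, Prod.mk.injEq]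
    refine ⟨by ring, by ring, by field_simp; ring⟩
  by_cases hs : s = 0
  · subst hs
    refine hB.trans ?_
    rw [← Fintype.card_coe B, ← Finset.card_univ, ← Finset.card_powersetCard]
    refine Finset.card_le_ncard_of_injOn _ _ (fun T => T.map ⟨Sum.inr, Sum.inr_injective⟩) ?_
      (Finset.map_injective _).injOn
    intro T hT
    obtain ⟨x, y, hxy, rfl⟩ := Finset.card_eq_two.1 (Finset.mem_powersetCard.1 hT).2
    rw [Finset.map_insert, Finset.map_singleton]
    have hne : (y : K) - x ≠ 0 := sub_ne_zero.2 fun h => hxy (Subtype.ext h.symm)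
    refine mem_spanningPairs_pair (by simpa using hxy) (t - (z - t * x) / (y - x))
      ((z - t * x) / (y - x)) ?_
    simp only [twoLines, Function.Embedding.coeFn_mk, Sum.elim_inr, Prod.smul_mk, smul_eq_mul,
      Prod.mk_add_mk, Prod.mk.injEq]
    refine ⟨by ring, by ring, by field_simp; ring⟩
  have key : ∀ y : (A.image (fun x => z / t + -(s / t) * x) ∩ B : Finset K),
      ∃ T ∈ spanningPairs (K := K) (twoLines A B) (s, t, z),
        ∀ y' : B, Sum.inr y' ∈ T ↔ (y' : K) = y := by
    rintro ⟨y, hy⟩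
    rw [Finset.mem_inter, Finset.mem_image] at hy
    obtain ⟨⟨x, hx, hxy⟩, hyB⟩ := hy
    refine ⟨{Sum.inl ⟨x, hx⟩, Sum.inr ⟨y, hyB⟩}, mem_spanningPairs_pair (by simp) s t ?_, ?_⟩
    · simp only [twoLines, Sum.elim_inl, Sum.elim_inr, Prod.smul_mk, smul_eq_mul,
        Prod.mk_add_mk, Prod.mk.injEq]
      refine ⟨by ring, by ring, ?_⟩
      rw [← hxy]; field_simp; ring
    · intro y'
      simp [Subtype.ext_iff]
  choose T hT hT' using key
  refine (hAB (-(s / t)) (z / t) (neg_ne_zero.2 (div_ne_zero hs ht))).trans ?_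
  rw [← Fintype.card_coe, ← Finset.card_univ]
  refine Finset.card_le_ncard_of_injOn _ _ T (fun y _ => hT y) ?_
  intro y _ y' _ h
  have := (hT' y ⟨y, (Finset.mem_inter.1 y.2).2⟩).2 rfl
  rw [h, hT'] at this
  exact Subtype.ext this

end Plane

/-! ### Lifting a plane saturating set to higher dimension -/

section Lift

variable {K F V J T : Type*} [Field K] [Field F] [Algebra K F] [AddCommGroup V] [Module K V]

/-- Each vector `h j` is extended by all vectors `(ξ, β j * ξ)`, `ξ ∈ F`; moreover each line
`y = γ t * x` of the `F`-plane contributes its points over `K`. If the slopes `β j`, `γ t` are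
distinct, then any two of these lines are complementary subspaces of `F × F`. -/
noncomputable def liftVectors (h : J → V) (β : J → F) (γ : T → F) :
    (J × F) ⊕ (T × ℙ K F) → V × F × F :=
  Sum.elim (fun p => (h p.1, p.2, β p.1 * p.2)) (fun p => (0, p.2.rep, γ p.1 * p.2.rep))

variable {h : J → V} {β : J → F} {γ : T → F}

theorem representsDistinct_liftVectors (hh : RepresentsDistinct K h) (hγ : Function.Injective γ) :
    RepresentsDistinct K (liftVectors (K := K) h β γ) := by
  refine ⟨?_, ?_⟩
  · rintro (⟨j, ξ⟩ | ⟨t, P⟩)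
    · intro h0
      exact hh.1 j (congrArg Prod.fst h0)
    · intro h0
      exact P.rep_nonzero (congrArg (fun x => x.2.1) h0)
  · rintro (⟨j, ξ⟩ | ⟨t, P⟩) (⟨j', ξ'⟩ | ⟨t', P'⟩) a h0 <;>
      simp only [liftVectors, Sum.elim_inl, Sum.elim_inr, Prod.smul_mk, Prod.mk.injEq,
        smul_zero] at h0
    · obtain ⟨h1, h2, -⟩ := h0
      obtain rfl := hh.2 j j' a h1
      have ha : a = 1 := by
        have : (1 - a) • h j = 0 := by rw [sub_smul, one_smul, ← h1, sub_self]
        rcases smul_eq_zero.1 this with h3 | h3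
        · exact (sub_eq_zero.1 h3).symm
        · exact absurd h3 (hh.1 j)
      rw [h2, ha, one_smul]
    · exact absurd h0.1 (hh.1 j)
    · have ha : a = 0 := (smul_eq_zero.1 h0.1.symm).resolve_right (hh.1 j')
      exact absurd (h0.2.1.trans (by rw [ha, zero_smul])) P.rep_nonzero
    · obtain ⟨-, h2, h3⟩ := h0
      have hP : P = P' := by
        rw [← P.mk_rep, ← P'.mk_rep, Projectivization.mk_eq_mk_iff']
        exact ⟨a, h2.symm⟩
      rw [← mul_smul_comm, ← h2] at h3
      rw [hγ (mul_right_cancel₀ P.rep_nonzero h3), hP]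

theorem exists_add_eq_of_ne {β γ : F} (hne : β ≠ γ) (b c : F) :
    ∃ u u' : F, u + u' = b ∧ β * u + γ * u' = c := by
  have h1 : γ - β ≠ 0 := sub_ne_zero.2 hne.symm
  refine ⟨(γ * b - c) / (γ - β), (c - β * b) / (γ - β), ?_, ?_⟩ <;> field_simp <;> ring

theorem exists_smul_rep_mk {u : F} (hu : u ≠ 0) :
    ∃ r : K, r • (Projectivization.mk K u hu).rep = u := by
  obtain ⟨a, ha⟩ := Projectivization.exists_smul_eq_mk_rep K u hu
  refine ⟨(a⁻¹ : Kˣ), ?_⟩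
  rw [← ha]
  exact inv_smul_smul a u

variable [Fintype J] [Fintype T] [Finite F] {μ : ℕ}

/-- The lifted set is saturating. Over a point `a` of the plane outside the given set, each pair
spanning `a` lifts to exactly one pair spanning `(a, b, c)`, since two lines with different slopes
are complementary. Over a point `h j` the pairs consist of one vector over `h j` and one vector on
one of the lines with slopes `γ t`, and over the zero vector each two of these lines provide a
pair. -/
theorem le_ncard_spanningPairs_liftVectors (hβγ : ∀ j t, β j ≠ γ t) (hβ : Function.Injective β)
    (hγ : Function.Injective γ) (hT : μ ≤ Fintype.card T) (hT2 : μ ≤ (Fintype.card T).choose 2)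
    (hplane : ∀ a : V, μ ≤ (spanningPairs (K := K) h a).ncard) {w : V × F × F}
    (hw : ∀ i (r : K), r • liftVectors (K := K) h β γ i ≠ w) (hw0 : w ≠ 0) :
    μ ≤ (spanningPairs (K := K) (liftVectors (K := K) h β γ) w).ncard := by
  classical
  obtain ⟨a, b, c⟩ := w
  by_cases ha : a = 0
  · subst ha
    have hne : ∀ t, c ≠ γ t * b := by
      rintro t rfl
      have hb : b ≠ 0 := by rintro rfl; simp at hw0
      obtain ⟨r, hr⟩ := exists_smul_rep_mk (K := K) hb
      refine hw (Sum.inr (t, Projectivization.mk K b hb)) r ?_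
      simp only [liftVectors, Sum.elim_inr, Prod.smul_mk, smul_zero]
      rw [← mul_smul_comm, hr]
    have key : ∀ S : {S : Finset T // S.card = 2},
        ∃ S' ∈ spanningPairs (K := K) (liftVectors (K := K) h β γ) (0, b, c),
          ∀ t, (∃ P, Sum.inr (t, P) ∈ S') ↔ t ∈ S.1 := by
      rintro ⟨S, hS⟩
      obtain ⟨t, t', htt, rfl⟩ := Finset.card_eq_two.1 hS
      obtain ⟨u, u', h1, h2⟩ := exists_add_eq_of_ne (fun h => htt (hγ h)) b c
      have hu : u ≠ 0 := by
        rintro rfl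
        exact hne t' (by rw [← h1, ← h2]; ring)
      have hu' : u' ≠ 0 := by
        rintro rfl
        exact hne t (by rw [← h1, ← h2]; ring)
      obtain ⟨r, hr⟩ := exists_smul_rep_mk (K := K) hu
      obtain ⟨r', hr'⟩ := exists_smul_rep_mk (K := K) hu'
      refine ⟨{Sum.inr (t, Projectivization.mk K u hu), Sum.inr (t', Projectivization.mk K u' hu')},
        mem_spanningPairs_pair (by simp [htt]) r r' ?_, ?_⟩
      · simp only [liftVectors, Sum.elim_inr, Prod.smul_mk, smul_zero, Prod.mk_add_mk, add_zero]
        rw [← mul_smul_comm, ← mul_smul_comm, hr, hr', h1, h2]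
      · intro x
        simp [exists_or]
    choose f hf hf' using key
    refine hT2.trans ?_
    rw [← Fintype.card_finset_len, ← Finset.card_univ]
    refine Finset.card_le_ncard_of_injOn _ _ f (fun S _ => hf S) ?_
    intro S _ S' _ hSS
    refine Subtype.ext (Finset.ext fun t => ?_)
    rw [← hf' S, hSS, hf' S']
  by_cases hj : ∃ j, ∃ r : K, r • h j = a
  · obtain ⟨j, r, rfl⟩ := hj
    have hr : r ≠ 0 := by rintro rfl; simp at ha
    have hc : c ≠ β j * b := by
      rintro rfl
      refine hw (Sum.inl (j, r⁻¹ • b)) r ?_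
      simp only [liftVectors, Sum.elim_inl, Prod.smul_mk]
      rw [← mul_smul_comm, smul_inv_smul₀ hr]
    have key : ∀ t : T, ∃ S' ∈ spanningPairs (K := K) (liftVectors (K := K) h β γ) (r • h j, b, c),
        ∀ t', (∃ P, Sum.inr (t', P) ∈ S') ↔ t' = t := by
      intro t
      obtain ⟨u, u', h1, h2⟩ := exists_add_eq_of_ne (hβγ j t) b c
      have hu' : u' ≠ 0 := by
        rintro rfl
        exact hc (by rw [← h1, ← h2]; ring)
      obtain ⟨r', hr'⟩ := exists_smul_rep_mk (K := K) hu'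
      refine ⟨{Sum.inl (j, r⁻¹ • u), Sum.inr (t, Projectivization.mk K u' hu')},
        mem_spanningPairs_pair (by simp) r r' ?_, ?_⟩
      · simp only [liftVectors, Sum.elim_inl, Sum.elim_inr, Prod.smul_mk, smul_zero,
          Prod.mk_add_mk, add_zero]
        rw [← mul_smul_comm, ← mul_smul_comm, hr', smul_inv_smul₀ hr, h1, h2]
      · intro x
        simp
    choose f hf hf' using key
    refine hT.trans ?_
    rw [← Finset.card_univ]
    refine Finset.card_le_ncard_of_injOn _ _ f (fun t _ => hf t) ?_
    intro t _ t' _ htt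
    rw [← hf' t', ← htt, hf' t]
  · push Not at hj
    have key : ∀ S : Finset J, S ∈ spanningPairs (K := K) h a →
        ∃ S' ∈ spanningPairs (K := K) (liftVectors (K := K) h β γ) (a, b, c),
          ∀ j, (∃ ξ, Sum.inl (j, ξ) ∈ S') ↔ j ∈ S := by
      intro S hS
      obtain ⟨i, j, hij, rfl, x, y, hxy⟩ := exists_of_mem_spanningPairs hS
      have hx : x ≠ 0 := by
        rintro rfl
        exact hj j y (by rw [← hxy, zero_smul, zero_add])
      have hy : y ≠ 0 := by
        rintro rfl
        exact hj i x (by rw [← hxy, zero_smul, add_zero])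
      obtain ⟨u, u', h1, h2⟩ := exists_add_eq_of_ne (fun h => hij (hβ h)) b c
      refine ⟨{Sum.inl (i, x⁻¹ • u), Sum.inl (j, y⁻¹ • u')},
        mem_spanningPairs_pair (by simp [hij]) x y ?_, ?_⟩
      · simp only [liftVectors, Sum.elim_inl, Prod.smul_mk, Prod.mk_add_mk]
        rw [← mul_smul_comm, ← mul_smul_comm, smul_inv_smul₀ hx, smul_inv_smul₀ hy, h1, h2, hxy]
      · intro k
        simp [exists_or]
    choose! f hf hf' using key
    refine (hplane a).trans (Set.ncard_le_ncard_of_injOn f hf ?_ (Set.toFinite _))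
    intro S hS S' hS' hSS
    refine Finset.ext fun j => ?_
    rw [← hf' S hS, hSS, hf' S' hS']

end Lift

/-- Lifting a two-line set of the plane to `PG(2m + 2, q)`. -/
theorem exists_isSaturating_of_meetsAffineImages {K : Type*} [Field K] [Fintype K] [DecidableEq K]
    {μ m N k : ℕ} (hm : m ≠ 0) (hN : N = 2 * m + 2) {A B : Finset K}
    (hAB : MeetsAffineImages μ A B) (hA : μ ≤ A.card.choose 2) (hB : μ ≤ B.card.choose 2)
    (hk : μ ≤ k) (hk2 : μ ≤ k.choose 2) (hcard : A.card + B.card + k ≤ Fintype.card K ^ m) :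
    ∃ S : Set (PG K N), IsSaturating μ S ∧ S ≠ Set.univ ∧ ∃ n : ℕ,
      n * (Fintype.card K - 1) = Fintype.card K ^ m - 1 ∧
      S.ncard = (A.card + B.card) * Fintype.card K ^ m + k * n := by
  classical
  obtain ⟨p, hp⟩ := CharP.exists K
  have hpp : Fact p.Prime := ⟨CharP.char_is_prime K p⟩
  have : NeZero m := ⟨hm⟩
  let F := FiniteField.Extension K p m
  have hF : Nat.card F = Fintype.card K ^ m := by
    rw [FiniteField.natCard_extension, Nat.card_eq_fintype_card]
  have : Fintype F := Fintype.ofFinite F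
  have hrank : Module.finrank K F = m := by
    have h1 := Module.natCard_eq_pow_finrank (K := K) (V := F)
    rw [hF, Nat.card_eq_fintype_card] at h1
    exact (Nat.pow_right_injective (Fintype.one_lt_card (α := K)) h1).symm
  -- distinct slopes for the points of the plane set and for the additional lines
  obtain ⟨σ⟩ : Nonempty ((A ⊕ B) ⊕ Fin k ↪ F) := by
    apply Function.Embedding.nonempty_of_card_le
    rw [← Nat.card_eq_fintype_card (α := F), hF]
    simpa using hcard
  let v := liftVectors (K := K) (twoLines A B) (fun j => σ (Sum.inl j)) (fun t => σ (Sum.inr t))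
  have hv : RepresentsDistinct K v := representsDistinct_liftVectors
    (representsDistinct_twoLines A B) (σ.injective.comp Sum.inr_injective)
  have hsat : ∀ w, (∀ i (r : K), r • v i ≠ w) → w ≠ 0 →
      μ ≤ (spanningPairs (K := K) v w).ncard := by
    intro w hw hw0
    refine le_ncard_spanningPairs_liftVectors (fun j t h => ?_)
      (σ.injective.comp Sum.inl_injective) (σ.injective.comp Sum.inr_injective)
      (by simpa using hk) (by simpa using hk2)
      (le_ncard_spanningPairs_twoLines hAB hA hB) hw hw0
    exact absurd (σ.injective h) Sum.inl_ne_inr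
  let e : ((K × K × K) × F × F) ≃ₗ[K] (Fin (N + 1) → K) := by
    refine LinearEquiv.ofFinrankEq _ _ ?_
    simp only [Module.finrank_prod, Module.finrank_self, Module.finrank_fin_fun, hrank]
    omega
  have hv' := hv.map e
  have : Fintype (ℙ K F) := Fintype.ofFinite _
  refine ⟨Set.range fun i => Projectivization.mk K ((e ∘ v) i) (hv'.1 i), ?_, ?_,
    Nat.card (ℙ K F), ?_, ?_⟩
  · rw [isSaturating_range_iff hv']
    intro w hw hw0
    obtain ⟨w, rfl⟩ := e.surjective w
    rw [spanningPairs_map]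
    refine hsat w (fun i r h => hw i r ?_) (fun h => hw0 (by rw [h, map_zero]))
    rw [Function.comp_apply, ← map_smul, h]
  · -- the common point of the two lines does not belong to the set
    intro huniv
    have hne : e ((0, 0, 1), 0, 0) ≠ 0 := by
      rw [ne_eq, LinearEquiv.map_eq_zero_iff]
      simp
    have hmem : Projectivization.mk K _ hne ∈
      (Set.range fun i => Projectivization.mk K ((e ∘ v) i) (hv'.1 i)) := huniv ▸ Set.mem_univ _
    obtain ⟨i, hi⟩ := hmem
    obtain ⟨r, hr⟩ := (Projectivization.mk_eq_mk_iff' K _ _ hne (hv'.1 i)).1 hi.symm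
    rw [Function.comp_apply, ← map_smul, e.injective.eq_iff] at hr
    obtain (⟨x | y, ξ⟩ | ⟨t, P⟩) := i
    · simp only [v, liftVectors, twoLines, Sum.elim_inl, Prod.smul_mk, smul_eq_mul, mul_one,
        mul_zero, Prod.mk.injEq] at hr
      obtain ⟨⟨rfl, -, h1⟩, -⟩ := hr
      simp at h1
    · simp only [v, liftVectors, twoLines, Sum.elim_inl, Sum.elim_inr, Prod.smul_mk, smul_eq_mul,
        mul_one, mul_zero, Prod.mk.injEq] at hr
      obtain ⟨⟨-, rfl, h1⟩, -⟩ := hr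
      simp at h1
    · have := congrArg (fun x => x.1.2.2) hr
      simp [v, liftVectors] at this
  · have h1 := Projectivization.card K F
    rw [hF, Nat.card_eq_fintype_card (α := K)] at h1
    exact h1.symm
  · rw [← Set.image_univ, Set.ncard_image_of_injective, Set.ncard_univ, Nat.card_sum, Nat.card_prod,
      Nat.card_prod, hF, Nat.card_fin, Nat.card_sum, Nat.card_eq_finsetCard,
      Nat.card_eq_finsetCard]
    intro i j hij
    obtain ⟨a, ha⟩ := (Projectivization.mk_eq_mk_iff' K _ _ (hv'.1 i) (hv'.1 j)).1 hij
    exact hv'.2 i j a ha.symm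

/-! ### Numerical estimates -/

theorem one_le_log_of_three_le {q : ℕ} (hq : 3 ≤ q) : 1 ≤ Real.log ((q : ℝ) + 1) := by
  have h3 : (3 : ℝ) ≤ q := by exact_mod_cast hq
  rw [Real.le_log_iff_exp_le (by positivity)]
  linarith [Real.exp_one_lt_d9]

theorem four_le_log_of_ninetySeven_le {q : ℕ} (hq : 97 ≤ q) : 4 ≤ Real.log ((q : ℝ) + 1) := by
  have h3 : (97 : ℝ) ≤ q := by exact_mod_cast hq
  rw [Real.le_log_iff_exp_le (by positivity)]
  have h1 : Real.exp 4 = Real.exp 1 ^ 4 := by rw [← Real.exp_nat_mul]; norm_num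
  have h2 : Real.exp 1 ^ 4 ≤ 2.72 ^ 4 :=
    pow_le_pow_left₀ (Real.exp_pos 1).le (by linarith [Real.exp_one_lt_d9]) 4
  rw [h1]
  norm_num at h2
  linarith

theorem IsDMu.three_le {q μ : ℕ} {D : ℝ} (h : IsDMu q μ D) : 3 ≤ q := by
  rcases h with h | h | h | h | h <;> omega

theorem IsDMu.le_card {q μ : ℕ} {D : ℝ} (h : IsDMu q μ D) : μ ≤ q := by
  have h3 := h.three_le
  rcases h with h | h | h | h | h
  · omega
  · omega
  · omega
  · have h1 : (1 : ℝ) ≤ q := by exact_mod_cast (by omega : 1 ≤ q)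
    have h2 : √(q : ℝ) ≤ q := by
      rw [Real.sqrt_le_left (by positivity)]
      nlinarith
    exact_mod_cast h.1.trans h2
  · have hq : (3 : ℝ) ≤ q := by exact_mod_cast h3
    have hδ : 0 ≤ deltaQ q := by unfold deltaQ; positivity
    have : (μ : ℝ) ≤ q := by nlinarith [h.1, mul_nonneg hδ (by linarith : (0 : ℝ) ≤ q)]
    exact_mod_cast this

/-- Each row of the table has a factor `D` that is large enough for the greedy covering: with
`L = log (q + 1)` the exponent `D ^ 2 * L / 2`, reduced by a proportion `ρ` of boundary effects,
outweighs the number `exp (2 * L)` of affine maps and the factor `exp (μ - 1)`. In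
the last two rows `μ + 1 ≤ D`, and the bound `hlt` makes `q` large enough for `ρ = 1 / 3`. -/
theorem IsDMu.exists_ratio {q μ : ℕ} {D : ℝ} (h : IsDMu q μ D) (hμ : 2 ≤ μ)
    (hlt : D * √(((q : ℝ) + 1) * Real.log ((q : ℝ) + 1)) < q) :
    0 < D ∧ ∃ ρ : ℝ, ρ ≤ 1 / 3 ∧ (μ : ℝ) + 1 ≤ ρ * (D * √(((q : ℝ) + 1) * Real.log ((q : ℝ) + 1))) ∧
      2 * Real.log ((q : ℝ) + 1) + (μ - 1) ≤ D ^ 2 / 2 * (1 - ρ) * Real.log ((q : ℝ) + 1) := by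
  have hL := one_le_log_of_three_le h.three_le
  have hrow : (97 ≤ q) → 19 ≤ √(((q : ℝ) + 1) * Real.log ((q : ℝ) + 1)) ∧
      4 ≤ Real.log ((q : ℝ) + 1) := by
    intro hq
    have h4 := four_le_log_of_ninetySeven_le hq
    have hq' : (97 : ℝ) ≤ q := by exact_mod_cast hq
    refine ⟨Real.le_sqrt_of_sq_le ?_, h4⟩
    nlinarith
  have hμ' : (2 : ℝ) ≤ μ := by exact_mod_cast hμ
  have hlarge : (μ : ℝ) + 1 ≤ D → 0 < D ∧ ∃ ρ : ℝ, ρ ≤ 1 / 3 ∧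
      (μ : ℝ) + 1 ≤ ρ * (D * √(((q : ℝ) + 1) * Real.log ((q : ℝ) + 1))) ∧
      2 * Real.log ((q : ℝ) + 1) + (μ - 1) ≤ D ^ 2 / 2 * (1 - ρ) * Real.log ((q : ℝ) + 1) := by
    intro hD
    set L := Real.log ((q : ℝ) + 1) with hLdef
    have hy : 0 ≤ ((q : ℝ) + 1) * L := by positivity
    have hs := Real.sq_sqrt hy
    have hs0 := Real.sqrt_nonneg (((q : ℝ) + 1) * L)
    set r := √(((q : ℝ) + 1) * L)
    have hr : 3 ≤ r := by
      have h1 : 3 * r < q + 1 := by nlinarith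
      by_contra hr
      push Not at hr
      have h2 : (q : ℝ) + 1 ≤ r ^ 2 := by rw [hs]; nlinarith
      nlinarith
    have hD2 : ((μ : ℝ) + 1) * 3 ≤ D ^ 2 := by nlinarith
    refine ⟨by linarith, 1 / 3, le_rfl, by nlinarith, ?_⟩
    nlinarith [mul_le_mul_of_nonneg_right hD2 (by linarith : 0 ≤ L)]
  rcases h with ⟨rfl, hq, rfl⟩ | ⟨rfl, hq, rfl⟩ | ⟨rfl, hq, rfl⟩ | ⟨-, -, rfl⟩ | ⟨-, -, rfl⟩
  · obtain ⟨hr, h4⟩ := hrow hq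
    refine ⟨by norm_num, 1 / 6, by norm_num, ?_, ?_⟩ <;> push_cast <;> linarith
  · obtain ⟨hr, h4⟩ := hrow (by omega)
    refine ⟨by norm_num, 1 / 6, by norm_num, ?_, ?_⟩ <;> push_cast <;> linarith
  · obtain ⟨hr, h4⟩ := hrow (by omega)
    refine ⟨by norm_num, 1 / 6, by norm_num, ?_, ?_⟩ <;> push_cast <;> linarith
  · exact hlarge le_rfl
  · exact hlarge (by linarith)

/-- The numerical condition of the greedy covering for `q * (q - 1)` affine maps. -/
theorem mul_pow_lt_of_ratio {q μ s : ℕ} {D ρ s₀ : ℝ} (hq : 3 ≤ q) (hμ : 2 ≤ μ)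
    (hs₀ : s₀ = D * √(((q : ℝ) + 1) * Real.log ((q : ℝ) + 1)))
    (hs₀0 : 0 ≤ s₀) (hs : s₀ - 1 ≤ s) (hsq : s ≤ q) (hρ : ρ ≤ 1 / 3) (hμρ : (μ : ℝ) + 1 ≤ ρ * s₀)
    (hD : 2 * Real.log ((q : ℝ) + 1) + (μ - 1) ≤ D ^ 2 / 2 * (1 - ρ) * Real.log ((q : ℝ) + 1)) :
    (((q - 1) * q : ℕ) : ℝ) * (1 - ((s : ℝ) + 1 - μ) / (2 * q)) ^ s < (1 / 2) ^ (μ - 1) := by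
  have hL := one_le_log_of_three_le hq
  set L := Real.log ((q : ℝ) + 1) with hLdef
  have hμ' : (2 : ℝ) ≤ μ := by exact_mod_cast hμ
  have hq' : (3 : ℝ) ≤ q := by exact_mod_cast hq
  have hsq' : (s : ℝ) ≤ q := by exact_mod_cast hsq
  have hs3 : 3 * ((μ : ℝ) + 1) ≤ s₀ := by nlinarith
  have hsq₀ : s₀ ^ 2 = D ^ 2 * ((q + 1) * L) := by
    rw [hs₀, mul_pow, Real.sq_sqrt (by positivity)]
  have hexp : 2 * L + (μ - 1) ≤ ((s : ℝ) + 1 - μ) / (2 * q) * s := by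
    have h1 : (s₀ - μ) * (s₀ - 1) ≤ ((s : ℝ) + 1 - μ) * s :=
      mul_le_mul (by linarith) hs (by linarith) (by linarith)
    have h2 : (1 - ρ) * s₀ ^ 2 ≤ (s₀ - μ) * (s₀ - 1) := by nlinarith
    have h3 : (2 * L + (μ - 1)) * (2 * q) ≤ (1 - ρ) * s₀ ^ 2 := by
      rw [hsq₀]
      have h4 : 0 ≤ D ^ 2 * (1 - ρ) * L := by
        have : 0 ≤ 1 - ρ := by linarith
        positivity
      nlinarith
    rw [div_mul_eq_mul_div, le_div_iff₀ (by positivity)]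
    linarith
  have hx0 : 0 ≤ 1 - ((s : ℝ) + 1 - μ) / (2 * q) := by
    rw [sub_nonneg, div_le_one (by positivity)]
    linarith
  have hpow : (1 - ((s : ℝ) + 1 - μ) / (2 * q)) ^ s ≤ Real.exp (-(2 * L) - ((μ - 1 : ℕ) : ℝ)) := by
    calc (1 - ((s : ℝ) + 1 - μ) / (2 * q)) ^ s
        ≤ Real.exp (-(((s : ℝ) + 1 - μ) / (2 * q))) ^ s :=
          pow_le_pow_left₀ hx0 (Real.one_sub_le_exp_neg _) s
      _ = Real.exp (-(((s : ℝ) + 1 - μ) / (2 * q) * s)) := by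
          rw [← Real.exp_nat_mul]; ring_nf
      _ ≤ _ := by
          rw [Real.exp_le_exp, Nat.cast_sub (by omega)]
          push_cast
          linarith
  have h2L : Real.exp (-(2 * L)) = (((q : ℝ) + 1) ^ 2)⁻¹ := by
    rw [Real.exp_neg, two_mul, Real.exp_add, hLdef, Real.exp_log (by positivity), sq]
  have hhalf : Real.exp (-((μ - 1 : ℕ) : ℝ)) ≤ (1 / 2) ^ (μ - 1) := by
    have h1 : Real.exp (-1) ≤ 1 / 2 := by
      rw [Real.exp_neg, one_div]
      exact inv_anti₀ two_pos (by linarith [Real.add_one_le_exp 1])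
    calc Real.exp (-((μ - 1 : ℕ) : ℝ)) = Real.exp (-1) ^ (μ - 1) := by
          rw [← Real.exp_nat_mul]; ring_nf
      _ ≤ _ := pow_le_pow_left₀ (Real.exp_pos _).le h1 _
  have hcount : (((q - 1) * q : ℕ) : ℝ) * (((q : ℝ) + 1) ^ 2)⁻¹ < 1 := by
    rw [← div_eq_mul_inv, div_lt_one (by positivity), Nat.cast_mul, Nat.cast_sub (by omega)]
    push_cast
    nlinarith
  calc (((q - 1) * q : ℕ) : ℝ) * (1 - ((s : ℝ) + 1 - μ) / (2 * q)) ^ s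
      ≤ (((q - 1) * q : ℕ) : ℝ) * Real.exp (-(2 * L) - ((μ - 1 : ℕ) : ℝ)) :=
        mul_le_mul_of_nonneg_left hpow (Nat.cast_nonneg _)
    _ = (((q - 1) * q : ℕ) : ℝ) * (((q : ℝ) + 1) ^ 2)⁻¹ * Real.exp (-((μ - 1 : ℕ) : ℝ)) := by
        rw [sub_eq_add_neg, Real.exp_add, h2L, mul_assoc]
    _ < 1 * Real.exp (-((μ - 1 : ℕ) : ℝ)) := mul_lt_mul_of_pos_right hcount (Real.exp_pos _)
    _ ≤ _ := by rw [one_mul]; exact hhalf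

theorem Nat.le_choose_two {n : ℕ} (hn : 3 ≤ n) : n ≤ n.choose 2 := by
  rw [Nat.choose_two_right, Nat.le_div_iff_mul_le two_pos]
  exact Nat.mul_le_mul_left n (by omega)

/-- Two subsets of the field as needed for a saturating set on two lines. If the bound on their
sizes exceeds `q`, then the whole field serves for both. -/
theorem exists_meetsAffineImages {K : Type*} [Field K] [Fintype K] [DecidableEq K] {μ : ℕ} {D : ℝ}
    (hμ : 2 ≤ μ) (hD : IsDMu (Fintype.card K) μ D) :
    ∃ A B : Finset K, MeetsAffineImages μ A B ∧ μ ≤ A.card.choose 2 ∧ μ ≤ B.card.choose 2 ∧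
      ((A.card + B.card : ℕ) : ℝ) ≤
        2 * D * √(((Fintype.card K : ℝ) + 1) * Real.log ((Fintype.card K : ℝ) + 1)) := by
  have h3 := hD.three_le
  have himage : ∀ (A : Finset K) (t z : K), t ≠ 0 →
      (A.image (fun x => z + t * x)).card = A.card := by
    intro A t z ht
    refine Finset.card_image_of_injective _ fun x y hxy => ?_
    exact mul_left_cancel₀ ht (add_left_cancel hxy)
  by_cases hlt : D * √(((Fintype.card K : ℝ) + 1) * Real.log ((Fintype.card K : ℝ) + 1)) <
      Fintype.card K
  · obtain ⟨hD0, ρ, hρ, hμρ, hρD⟩ := hD.exists_ratio hμ hlt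
    set s₀ := D * √(((Fintype.card K : ℝ) + 1) * Real.log ((Fintype.card K : ℝ) + 1)) with hs₀
    have hnn : 0 ≤ s₀ := by positivity
    have hμ' : (2 : ℝ) ≤ μ := by exact_mod_cast hμ
    have hle : (⌊s₀⌋₊ : ℝ) ≤ s₀ := Nat.floor_le hnn
    have hge : s₀ - 1 ≤ (⌊s₀⌋₊ : ℝ) := (Nat.sub_one_lt_floor s₀).le
    set s := ⌊s₀⌋₊
    have hsq : s ≤ Fintype.card K := by exact_mod_cast hle.trans hlt.le
    have hs : μ + 1 ≤ s := by
      have : (μ : ℝ) + 1 ≤ s := by nlinarith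
      exact_mod_cast this
    obtain ⟨A, -, hA⟩ := Finset.exists_subset_card_eq (s := (Finset.univ : Finset K)) (n := s)
      (by rwa [Finset.card_univ])
    obtain ⟨B, hB, hAB⟩ := exists_card_inter_ge (μ := μ) (a := s)
      (fun i : Kˣ × K => A.image (fun x => i.2 + i.1 * x)) (by omega)
      (fun i => (himage A _ _ i.1.ne_zero).trans hA) hsq (by omega) s hsq (by
        rw [Fintype.card_prod, Fintype.card_units]
        exact mul_pow_lt_of_ratio h3 hμ hs₀ hnn hge hsq hρ hμρ hρD)
    refine ⟨A, B, fun t z ht => hAB (Units.mk0 t ht, z), ?_, ?_, ?_⟩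
    · rw [hA]; exact (by omega : μ ≤ s).trans (Nat.le_choose_two (by omega))
    · rw [hB]; exact (by omega : μ ≤ s).trans (Nat.le_choose_two (by omega))
    · rw [hA, hB, mul_assoc, ← hs₀]
      push_cast
      linarith
  · push Not at hlt
    have hμq := hD.le_card
    have hc : μ ≤ (Finset.univ : Finset K).card.choose 2 := by
      rw [Finset.card_univ]; exact hμq.trans (Nat.le_choose_two h3)
    refine ⟨Finset.univ, Finset.univ, fun t z ht => ?_, hc, hc, ?_⟩
    · rw [Finset.inter_univ, himage _ _ _ ht, Finset.card_univ]
      exact hμq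
    · rw [Finset.card_univ]
      push_cast
      linarith

/-! ### The asymptotic size of the bound -/

theorem IsDMu.le_two_mul {q μ : ℕ} {D : ℝ} (h : IsDMu q μ D) (hμ : 2 ≤ μ) :
    max 3 (μ : ℝ) ≤ 2 * D ∧ 2 ≤ 2 * D := by
  have hμ' : (2 : ℝ) ≤ μ := by exact_mod_cast hμ
  rcases h with ⟨rfl, -, rfl⟩ | ⟨rfl, -, rfl⟩ | ⟨rfl, -, rfl⟩ | ⟨-, -, rfl⟩ | ⟨-, -, rfl⟩
  · norm_num
  · norm_num
  · norm_num
  · exact ⟨max_le (by linarith) (by linarith), by linarith⟩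
  · exact ⟨max_le (by linarith) (by linarith), by linarith⟩

theorem sqrt_mul_log_add_one_isEquivalent {q : ℕ → ℕ} (hq : Tendsto q atTop atTop) :
    (fun i => √(((q i : ℝ) + 1) * Real.log ((q i : ℝ) + 1))) ~[atTop]
      fun i => √((q i : ℝ) * Real.log (q i : ℝ)) := by
  have hx : Tendsto (fun i => (q i : ℝ)) atTop atTop := tendsto_natCast_atTop_atTop.comp hq
  have h1 : (fun i => (q i : ℝ) + 1) ~[atTop] fun i => (q i : ℝ) := by
    refine IsEquivalent.refl.add_isLittleO ?_
    rw [isLittleO_const_left]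
    exact Or.inr (tendsto_norm_atTop_atTop.comp hx)
  have h2 := IsEquivalent.rpow (r := 1 / 2)
    (fun i => mul_nonneg (Nat.cast_nonneg (q i)) (Real.log_natCast_nonneg (q i)))
    (h1.mul (h1.log hx))
  refine (h2.congr_left (.of_forall fun i => ?_)).congr_right (.of_forall fun i => ?_) <;>
  exact (Real.sqrt_eq_rpow _).symm

theorem spaceBound_isEquivalent {N : ℕ} (hN : 4 ≤ N) (hNeven : Even N) {q μ : ℕ → ℕ} {D : ℕ → ℝ}
    (hq : Tendsto q atTop atTop) (hD : ∀ᶠ i in atTop, 2 ≤ μ i ∧ IsDMu (q i) (μ i) (D i)) :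
    (fun i => spaceBound N (q i) (μ i) (D i)) ~[atTop]
      (fun i => 2 * D i * (q i : ℝ) ^ (((N : ℝ) - 1) / 2) * √(Real.log (q i : ℝ))) := by
  obtain ⟨m, rfl⟩ : ∃ m, N = 2 * m + 2 := by
    obtain ⟨k, rfl⟩ := hNeven
    exact ⟨k - 1, by omega⟩
  have hm : (2 * m + 2 - 2) / 2 = m := by omega
  have hx : Tendsto (fun i => (q i : ℝ)) atTop atTop := tendsto_natCast_atTop_atTop.comp hq
  have hmain : (fun i => 2 * D i * (q i : ℝ) ^ m * √(((q i : ℝ) + 1) * Real.log ((q i : ℝ) + 1)))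
      ~[atTop] fun i => 2 * D i * (q i : ℝ) ^ m * √((q i : ℝ) * Real.log (q i : ℝ)) :=
    IsEquivalent.refl.mul (sqrt_mul_log_add_one_isEquivalent hq)
  have hgrow : Tendsto (fun i => √((q i : ℝ) * Real.log (q i : ℝ))) atTop atTop :=
    Real.tendsto_sqrt_atTop.comp (hx.atTop_mul_atTop₀ (Real.tendsto_log_atTop.comp hx))
  have hrest : (fun i => (q i : ℝ) ^ m * 2 +
      max 3 (μ i : ℝ) * (((q i : ℝ) ^ m - 1) / ((q i : ℝ) - 1))) =o[atTop]
      fun i => 2 * D i * (q i : ℝ) ^ m * √((q i : ℝ) * Real.log (q i : ℝ)) := by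
    have hO : (fun i => (q i : ℝ) ^ m * 2 +
        max 3 (μ i : ℝ) * (((q i : ℝ) ^ m - 1) / ((q i : ℝ) - 1))) =O[atTop]
        fun i => 2 * D i * (q i : ℝ) ^ m := by
      refine IsBigO.of_bound 2 ?_
      filter_upwards [hD] with i hi
      have h3 : (3 : ℝ) ≤ q i := by exact_mod_cast hi.2.three_le
      obtain ⟨hmax, hD2⟩ := hi.2.le_two_mul hi.1
      have hp : (1 : ℝ) ≤ (q i : ℝ) ^ m := one_le_pow₀ (by linarith)
      have hd0 : 0 ≤ ((q i : ℝ) ^ m - 1) / ((q i : ℝ) - 1) :=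
        div_nonneg (by linarith) (by linarith)
      have hd : ((q i : ℝ) ^ m - 1) / ((q i : ℝ) - 1) ≤ (q i : ℝ) ^ m := by
        rw [div_le_iff₀ (by linarith)]
        nlinarith
      have hmax0 : 0 ≤ max 3 (μ i : ℝ) := by positivity
      rw [Real.norm_of_nonneg (by positivity), Real.norm_of_nonneg (by nlinarith)]
      have := mul_le_mul hmax hd hd0 (by linarith)
      nlinarith
    have ho : (fun _ => (1 : ℝ)) =o[atTop] fun i => √((q i : ℝ) * Real.log (q i : ℝ)) := by
      rw [isLittleO_const_left]
      exact Or.inr (tendsto_norm_atTop_atTop.comp hgrow)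
    simpa using hO.mul_isLittleO ho
  refine ((hmain.add_isLittleO hrest).congr_left ?_).congr_right ?_
  · refine Eventually.of_forall fun i => ?_
    simp only [spaceBound, nQMu, hm, Pi.add_apply]
    ring
  · filter_upwards [hD] with i hi
    have h3 : (0 : ℝ) < q i := by exact_mod_cast (by have := hi.2.three_le; omega : 0 < q i)
    have hexp : (((2 * m + 2 : ℕ) : ℝ) - 1) / 2 = m + 1 / 2 := by push_cast; ring
    rw [hexp, Real.rpow_add h3, Real.rpow_natCast, ← Real.sqrt_eq_rpow,
      Real.sqrt_mul h3.le]
    ring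

/-! ### Existence, equality of the minima, and the bound -/

theorem mainTheorem5 (N : ℕ) (hN : 4 ≤ N) (hNeven : Even N) :
    (∀ (K : Type*) [Field K] [Fintype K] [DecidableEq K] (μ : ℕ) (D : ℝ),
      2 ≤ μ → IsDMu (Fintype.card K) μ D →
      nQMu (Fintype.card K) D ≤ (Fintype.card K : ℝ) ^ ((N - 2) / 2) + 1 - (μ : ℝ) →
      (saturatingSizes K μ N).Nonempty ∧ (mcfLengths K μ 2 (N + 1)).Nonempty ∧
      sMu K μ N = ellMu K μ 2 (N + 1) ∧
      (sMu K μ N : ℝ) ≤ spaceBound N (Fintype.card K) μ D) ∧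
    (∀ (q μ : ℕ → ℕ) (D : ℕ → ℝ), Tendsto q atTop atTop →
      (∀ᶠ i in atTop, 2 ≤ μ i ∧ IsDMu (q i) (μ i) (D i)) →
      (fun i => spaceBound N (q i) (μ i) (D i)) ~[atTop]
        (fun i => 2 * D i * (q i : ℝ) ^ (((N : ℝ) - 1) / 2) * √(Real.log (q i : ℝ)))) := by
  refine ⟨?_, fun q μ D hq hD => spaceBound_isEquivalent hN hNeven hq hD⟩
  intro K _ _ _ μ D hμ hD hn
  obtain ⟨m, hm, hm0, hN2⟩ : ∃ m, (N - 2) / 2 = m ∧ m ≠ 0 ∧ N = 2 * m + 2 := by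
    obtain ⟨k, rfl⟩ := hNeven
    exact ⟨k - 1, by omega, by omega, by omega⟩
  unfold spaceBound
  rw [hm] at hn ⊢
  unfold nQMu at hn ⊢
  have h3 := hD.three_le
  obtain ⟨A, B, hAB, hA, hB, hsize⟩ := exists_meetsAffineImages hμ hD
  set q := Fintype.card K with hq
  -- The plane set has at most `nQMu q D - 2` points, which leaves room for the `max 3 μ ≤ μ + 1`
  -- additional slopes, all of them finite.
  have hcard : A.card + B.card + max 3 μ ≤ q ^ m := by
    have h1 : ((A.card + B.card : ℕ) : ℝ) + (μ + 1) ≤ (q : ℝ) ^ m := by linarith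
    have h2 : A.card + B.card + (μ + 1) ≤ q ^ m := by exact_mod_cast h1
    omega
  obtain ⟨S, hS, huniv, n, hn', hScard⟩ :=
    exists_isSaturating_of_meetsAffineImages hm0 hN2 hAB hA hB (le_max_right 3 μ)
      ((le_max_right 3 μ).trans (Nat.le_choose_two (le_max_left 3 μ))) hcard
  obtain ⟨h1, h2, h4, hle⟩ := sMu_eq_ellMu_of_isSaturating (by omega) hS huniv
  refine ⟨h1, h2, h4, ?_⟩
  have hq3 : (3 : ℝ) ≤ q := by exact_mod_cast h3
  have hnR : (n : ℝ) = ((q : ℝ) ^ m - 1) / ((q : ℝ) - 1) := by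
    rw [eq_div_iff (by linarith)]
    have h5 : ((n * (q - 1) : ℕ) : ℝ) = ((q ^ m - 1 : ℕ) : ℝ) := by rw [hn']
    rw [Nat.cast_mul, Nat.cast_sub (by omega), Nat.cast_sub (Nat.one_le_pow _ _ (by omega))] at h5
    exact_mod_cast h5
  calc (sMu K μ N : ℝ) ≤ S.ncard := by exact_mod_cast hle
    _ = ((A.card + B.card : ℕ) : ℝ) * (q : ℝ) ^ m + max 3 (μ : ℝ) * n := by
        rw [hScard]; push_cast; ring
    _ ≤ _ := by
        rw [hnR, mul_comm ((q : ℝ) ^ m)]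
        have : (0 : ℝ) ≤ (q : ℝ) ^ m := by positivity
        gcongr
        linarith
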